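/- Let $R$ be a commutative Noetherian ring which is reduced (that is, $R$ has no nonzero nilpotent elements). Call an $R$-module $M$ Hopfian (respectively co-Hopfian) if every surjective (respectively injective) $R$-module endomorphism of $M$ is an automorphism, and bi-Hopfian if it is both Hopfian and co-Hopfian. For an $R$-module $M$, let $E(M)$ denote its injective envelope, and for a natural number $n$ let $\bigoplus_n M$ denote the direct sum of $n$ copies of $M$. Then $R$ has only finitely many minimal prime ideals, and the following hold. (1) An injective $R$-module $E$ is bi-Hopfian if and only if there are non-negative integers $n_P$, one for each minimal prime ideal $P$ of $R$, such that $$E \cong \bigoplus_{P} \Bigl(\bigoplus_{n_P} E(R/P)\Bigr),$$ where the outer direct sum is taken over the minimal prime ideals $P$ of $R$. (2) If $Q$ is a prime ideal of $R$ that is not a minimal prime ideal, then $E(R/Q)$ is not Hopfian. -/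

import Mathlib

universe u v w

open scoped DirectSum

/-- `M` is Hopfian: every surjective endomorphism is an automorphism. -/
def IsHopfian (R : Type u) [Ring R] (M : Type v) [AddCommGroup M] [Module R M] : Prop :=
  ∀ f : M →ₗ[R] M, Function.Surjective f → Function.Bijective f

/-- `M` is co-Hopfian: every injective endomorphism is an automorphism. -/
def IsCoHopfian (R : Type u) [Ring R] (M : Type v) [AddCommGroup M] [Module R M] : Prop :=
  ∀ f : M →ₗ[R] M, Function.Injective f → Function.Bijective f

/-- `M` is bi-Hopfian: both Hopfian and co-Hopfian. -/
def IsBiHopfian (R : Type u) [Ring R] (M : Type v) [AddCommGroup M] [Module R M] : Prop :=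
  IsHopfian R M ∧ IsCoHopfian R M

/-- A submodule `N` of `E` is essential: it meets every nonzero submodule nontrivially. -/
def IsEssentialSubmodule {R : Type u} [Ring R] {E : Type v} [AddCommGroup E] [Module R E]
    (N : Submodule R E) : Prop :=
  ∀ L : Submodule R E, N ⊓ L = ⊥ → L = ⊥

/-- `i : M → E` is an injective envelope of `M`: an embedding of `M` as an essential submodule
of an injective module `E`. -/
structure IsInjectiveEnvelope {R : Type u} [Ring R] {M : Type v} [AddCommGroup M] [Module R M]
    {E : Type w} [AddCommGroup E] [Module R E] (i : M →ₗ[R] E) : Prop where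
  injective : Function.Injective i
  module_injective : Module.Injective R E
  essential : IsEssentialSubmodule (LinearMap.range i)

/-- Every module has an injective envelope. -/
theorem exists_isInjectiveEnvelope (R : Type u) [Ring R] [Small.{v} R]
    (M : Type v) [AddCommGroup M] [Module R M] :
    ∃ (E : ModuleCat.{v} R) (i : M →ₗ[R] E), IsInjectiveEnvelope i := by
  classical
  obtain ⟨I, j, hI, hj⟩ : ∃ (I : ModuleCat.{v} R) (j : M →ₗ[R] I),
      Module.Injective R I ∧ Function.Injective j := by
    let X : ModuleCat.{v} R := CategoryTheory.Injective.under (ModuleCat.of R M)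
    let i : ModuleCat.of R M ⟶ X := CategoryTheory.Injective.ι (ModuleCat.of R M)
    have hX : CategoryTheory.Injective X := CategoryTheory.Injective.injective_under _
    have hi : CategoryTheory.Mono i := CategoryTheory.Injective.ι_mono _
    exact ⟨X, i.hom, Module.injective_module_of_injective_object R X (inj := hX),
      (ModuleCat.mono_iff_injective i).1 hi⟩
  let N : Submodule R I := LinearMap.range j
  let S : Set (Submodule R I) :=
    {K | N ≤ K ∧ ∀ x ∈ K, x ≠ 0 → ∃ r : R, r • x ∈ N ∧ r • x ≠ 0}
  have hNS : N ∈ S := ⟨le_rfl, fun x hx h0 => ⟨1, by simpa using hx, by simpa using h0⟩⟩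
  obtain ⟨K, hNK, hK⟩ := zorn_le_nonempty₀ S (by
    intro c hc hch y hy
    refine ⟨sSup c, ⟨(hc hy).1.trans (le_sSup hy), ?_⟩, fun z hz => le_sSup hz⟩
    intro x hx h0
    obtain ⟨L, hL, hxL⟩ := (Submodule.mem_sSup_of_directed ⟨y, hy⟩ hch.directedOn).1 hx
    exact (hc hL).2 x hxL h0) N hNS
  -- A retraction of `I` onto `K`.
  obtain ⟨ρ, hρK, hρ⟩ : ∃ ρ : I →ₗ[R] I, (∀ x, ρ x ∈ K) ∧ ∀ x ∈ K, ρ x = x := by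
    obtain ⟨C, -, hC⟩ := zorn_le_nonempty₀ {C : Submodule R I | C ⊓ K = ⊥} (by
      intro c hc hch y hy
      refine ⟨sSup c, ?_, fun z hz => le_sSup hz⟩
      refine (Submodule.eq_bot_iff _).2 fun x hx => ?_
      obtain ⟨L, hL, hxL⟩ := (Submodule.mem_sSup_of_directed ⟨y, hy⟩ hch.directedOn).1 hx.1
      exact (Submodule.eq_bot_iff _).1 (hc hL) x ⟨hxL, hx.2⟩) ⊥ (by simp)
    let q : K →ₗ[R] I ⧸ C := C.mkQ ∘ₗ K.subtype
    have hq : Function.Injective q := by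
      rw [injective_iff_map_eq_zero]
      intro x hx
      have h1 : (x : I) ∈ C := (Submodule.Quotient.mk_eq_zero C).1 hx
      exact Subtype.ext ((Submodule.eq_bot_iff _).1 hC.prop x ⟨h1, x.2⟩)
    obtain ⟨φ, hφ⟩ := Module.Injective.extension_property R I K (I ⧸ C) q hq K.subtype
    have hφK : ∀ x (_ : x ∈ K), φ (C.mkQ x) = x := fun x hx => LinearMap.congr_fun hφ ⟨x, hx⟩
    refine ⟨φ ∘ₗ C.mkQ, ?_, hφK⟩
    -- every `x` outside `C` has a multiple congruent to a nonzero element of `K` modulo `C`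
    have key : ∀ x, x ∉ C → ∃ r : R, ∃ k ∈ K, k ≠ 0 ∧ C.mkQ (r • x) = C.mkQ k := by
      intro x hx
      by_contra hcon
      have hmem : C ⊔ Submodule.span R {x} ∈ {C : Submodule R I | C ⊓ K = ⊥} := by
        refine (Submodule.eq_bot_iff _).2 fun k hk => ?_
        by_contra hk0
        obtain ⟨c, hc, z, hz, hcz⟩ := Submodule.mem_sup.1 hk.1
        obtain ⟨r, rfl⟩ := Submodule.mem_span_singleton.1 hz
        refine hcon ⟨r, k, hk.2, hk0, ?_⟩
        have : C.mkQ c = 0 := (Submodule.Quotient.mk_eq_zero C).2 hc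
        rw [← hcz, map_add, this, zero_add]
      exact hx (hC.le_of_ge hmem le_sup_left (Submodule.mem_sup_right
        (Submodule.mem_span_singleton_self x)))
    have hRS : LinearMap.range (φ ∘ₗ C.mkQ) ∈ S := by
      refine ⟨fun x hx => ⟨x, hφK x (hNK hx)⟩, ?_⟩
      rintro _ ⟨x, rfl⟩ h0
      have hxC : x ∉ C := fun h => h0 (by
        have : C.mkQ x = 0 := (Submodule.Quotient.mk_eq_zero C).2 h
        rw [LinearMap.comp_apply, this, map_zero])
      obtain ⟨r, k, hk, hk0, hrk⟩ := key x hxC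
      obtain ⟨s, hs, hs0⟩ := hK.prop.2 k hk hk0
      have e : (s * r) • (φ ∘ₗ C.mkQ) x = s • k := by
        rw [mul_smul, ← map_smul, LinearMap.comp_apply, hrk, hφK k hk]
      exact ⟨s * r, e ▸ hs, e ▸ hs0⟩
    intro x
    exact hK.le_of_ge hRS (fun y hy => ⟨y, hφK y hy⟩) ⟨x, rfl⟩
  refine ⟨ModuleCat.of R K, j.codRestrict K fun x => hNK ⟨x, rfl⟩, ?_, ?_, ?_⟩
  · exact fun x y h => hj (congrArg Subtype.val h)
  · refine ⟨fun X Y _ _ _ _ f hf g => ?_⟩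
    obtain ⟨h, hh⟩ := hI.out f hf (K.subtype ∘ₗ g)
    refine ⟨(ρ.codRestrict K hρK) ∘ₗ h, fun x => Subtype.ext ?_⟩
    have h2 : h (f x) = (g x : K).1 := hh x
    change ρ (h (f x)) = (g x : K).1
    rw [h2]
    exact hρ _ (g x : K).2
  · intro L hL
    refine (Submodule.eq_bot_iff _).2 fun x hx => ?_
    by_contra h0
    obtain ⟨r, ⟨m, hm⟩, hr0⟩ := hK.prop.2 x.1 x.2 fun h => h0 (Subtype.ext h)
    have h3 := (Submodule.eq_bot_iff _).1 hL (r • x)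
      ⟨⟨m, Subtype.ext hm⟩, L.smul_mem r hx⟩
    exact hr0 (congrArg Subtype.val h3)

/-- The injective envelope `E(M)` of `M` (unique up to isomorphism). -/
noncomputable def injectiveEnvelope (R : Type u) [Ring R] [Small.{v} R]
    (M : Type v) [AddCommGroup M] [Module R M] : ModuleCat.{v} R :=
  (exists_isInjectiveEnvelope R M).choose

/-- The embedding of `M` into its injective envelope `E(M)`. -/
noncomputable def injectiveEnvelopeEmbedding (R : Type u) [Ring R] [Small.{v} R]
    (M : Type v) [AddCommGroup M] [Module R M] : M →ₗ[R] injectiveEnvelope R M :=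
  (exists_isInjectiveEnvelope R M).choose_spec.choose

theorem isInjectiveEnvelope_injectiveEnvelopeEmbedding (R : Type u) [Ring R] [Small.{v} R]
    (M : Type v) [AddCommGroup M] [Module R M] :
    IsInjectiveEnvelope (injectiveEnvelopeEmbedding R M) :=
  (exists_isInjectiveEnvelope R M).choose_spec.choose_spec

/-!
The regular elements of a reduced Noetherian ring are those outside all of its finitely many minimal
primes. By prime avoidance, a nonminimal prime `Q` contains a regular element. It acts surjectively
on `E(R/Q)`, as injective modules are divisible, but kills `R/Q`; so `E(R/Q)` is not Hopfian
(`IsInjectiveEnvelope.not_isHopfian`).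

If `E` is injective and Hopfian, then every regular element acts bijectively on `E`
(`IsHopfian.actsBijectively`), that is, `E` is a module over the total ring of fractions of `R`.
That ring is the product of the fields `R_P`, for `P` a minimal prime, so `E` is a direct sum of
vector spaces over these fields; this is carried out inside `E`, by decomposing it into its
`P`-torsion parts (`ActsBijectively.isInternal_torsionBySet`). If `E` is also co-Hopfian, then these
vector spaces are finite-dimensional (`IsCoHopfian.finite_of_finsupp`), and `R_P` is `E(R/P)`
(`IsInjectiveEnvelope.nonempty_linearEquiv_localization`).

Conversely, there are no nonzero maps between vector spaces over `R_P` and `R_Q` for `P ≠ Q`, so an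
endomorphism of a finite direct sum of the `R_P` is a family of endomorphisms of finite-dimensional
vector spaces, each of which is injective if and only if it is surjective
(`IsBiHopfian.directSum`, `isBiHopfian_finsupp_localization`).
-/

open scoped nonZeroDivisors

/-! ### Regular elements and minimal primes of a reduced ring -/

section MinimalPrimes
variable {R : Type u} [CommRing R]

theorem eq_zero_of_forall_mem_minimalPrimes [IsReduced R] {x : R}
    (h : ∀ P ∈ minimalPrimes R, x ∈ P) : x = 0 := by
  have hx : x ∈ sInf (minimalPrimes R) := Ideal.mem_sInf.2 fun {P} hP => h P hP
  rw [minimalPrimes, Ideal.sInf_minimalPrimes] at hx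
  simpa using (mem_nilradical.1 hx).eq_zero

theorem mem_nonZeroDivisors_of_forall_notMem_minimalPrimes [IsReduced R] {t : R}
    (h : ∀ P ∈ minimalPrimes R, t ∉ P) : t ∈ R⁰ := by
  refine mem_nonZeroDivisors_iff_right.2 fun x hx => ?_
  refine eq_zero_of_forall_mem_minimalPrimes fun P hP => ?_
  have : P.IsPrime := hP.1.1
  exact (this.mem_or_mem (hx ▸ P.zero_mem : x * t ∈ P)).resolve_right (h P hP)

theorem notMem_of_mem_nonZeroDivisors {t : R} (ht : t ∈ R⁰) {P : Ideal R}
    (hP : P ∈ minimalPrimes R) : t ∉ P :=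
  fun h => notMem_nonZeroDivisors_of_mem_mem_minimalPrimes h hP ht

theorem minimalPrimes_eq_of_le {P Q : Ideal R} (hP : P.IsPrime) (hQ : Q ∈ minimalPrimes R)
    (h : P ≤ Q) : P = Q :=
  le_antisymm h (hQ.2 ⟨hP, bot_le⟩ h)

/-- Prime avoidance: a prime contained in the finite union of the minimal primes, which is the set
of zero divisors, is itself minimal. -/
theorem exists_mem_nonZeroDivisors_of_notMem_minimalPrimes [IsNoetherianRing R] [IsReduced R]
    {Q : Ideal R} (hQ : Q.IsPrime) (hQm : Q ∉ minimalPrimes R) : ∃ r ∈ Q, r ∈ R⁰ := by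
  by_contra! hcon
  have hfin : (minimalPrimes R).Finite := minimalPrimes.finite_of_isNoetherianRing R
  have hsub : (Q : Set R) ⊆ ⋃ P ∈ (hfin.toFinset : Set (Ideal R)), (P : Set R) := by
    intro r hr
    by_contra hr'
    refine hcon r hr (mem_nonZeroDivisors_of_forall_notMem_minimalPrimes fun P hP hrP => hr' ?_)
    exact Set.mem_biUnion (by simpa using hP) hrP
  obtain ⟨P, hP, hQP⟩ := (Ideal.subset_union_prime (f := id) ⊥ ⊥
    (fun P hP _ _ => (hfin.mem_toFinset.1 hP).1.1)).1 hsub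
  have hP := hfin.mem_toFinset.1 hP
  exact hQm (minimalPrimes_eq_of_le hQ hP hQP ▸ hP)

/-- `r` separates the minimal primes: `r P` lies in every minimal prime except `P`. For a reduced
ring with finitely many minimal primes, the fractions `r P / ∑ Q, r Q` are the orthogonal
idempotents which cut the total ring of fractions into the fields `R_P`. -/
def SeparatesMinimalPrimes (r : minimalPrimes R → R) : Prop :=
  ∀ P Q : minimalPrimes R, r P ∈ (Q : Ideal R) ↔ P ≠ Q

theorem exists_separatesMinimalPrimes [Fintype (minimalPrimes R)] :
    ∃ r : minimalPrimes R → R, SeparatesMinimalPrimes r := by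
  classical
  have key : ∀ P Q : minimalPrimes R, ∃ x ∈ (Q : Ideal R), P ≠ Q → x ∉ (P : Ideal R) := by
    intro P Q
    by_cases h : P = Q
    · exact ⟨0, zero_mem _, fun h' => absurd h h'⟩
    · have : ¬ (Q : Ideal R) ≤ P := fun hle =>
        h (Subtype.ext (minimalPrimes_eq_of_le Q.2.1.1 P.2 hle).symm)
      obtain ⟨x, hx, hx'⟩ := SetLike.not_le_iff_exists.1 this
      exact ⟨x, hx, fun _ => hx'⟩
  choose x hx hx' using key
  refine ⟨fun P => ∏ Q ∈ Finset.univ.erase P, x P Q, fun P Q => ⟨?_, fun h => ?_⟩⟩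
  · rintro hmem rfl
    have := P.2.1.1
    obtain ⟨Q, hQ, hQP⟩ := (Ideal.IsPrime.prod_mem_iff).1 hmem
    exact hx' P Q (Finset.ne_of_mem_erase hQ).symm hQP
  · exact Ideal.mem_of_dvd _ (Finset.dvd_prod_of_mem _ (by simpa using h.symm)) (hx P Q)

namespace SeparatesMinimalPrimes
variable {r : minimalPrimes R → R}

theorem mul_eq_zero [IsReduced R] (hr : SeparatesMinimalPrimes r)
    {P : minimalPrimes R} {a : R} (ha : a ∈ (P : Ideal R)) :
    a * r P = 0 := by
  refine eq_zero_of_forall_mem_minimalPrimes fun Q hQ => ?_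
  by_cases h : P = ⟨Q, hQ⟩
  · subst h
    exact Ideal.mul_mem_right _ _ ha
  · exact Ideal.mul_mem_left _ _ ((hr P ⟨Q, hQ⟩).2 h)

theorem sum_sub_mem [Fintype (minimalPrimes R)] (hr : SeparatesMinimalPrimes r)
    (P : minimalPrimes R) :
    ∑ Q, r Q - r P ∈ (P : Ideal R) := by
  classical
  rw [← Finset.add_sum_erase _ _ (Finset.mem_univ P), add_sub_cancel_left]
  exact sum_mem fun Q hQ => (hr Q P).2 (Finset.ne_of_mem_erase hQ)

theorem sum_mem_nonZeroDivisors [Fintype (minimalPrimes R)] [IsReduced R]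
    (hr : SeparatesMinimalPrimes r) :
    ∑ Q, r Q ∈ R⁰ := by
  refine mem_nonZeroDivisors_of_forall_notMem_minimalPrimes fun P hP h => ?_
  refine (hr ⟨P, hP⟩ ⟨P, hP⟩).1 ?_ rfl
  simpa using sub_mem h (hr.sum_sub_mem ⟨P, hP⟩)

/-- Given `a` outside `P`, this regular element is congruent to `a * r P` modulo `P`. -/
theorem mul_add_mem_nonZeroDivisors [Fintype (minimalPrimes R)] [IsReduced R]
    (hr : SeparatesMinimalPrimes r) {P : minimalPrimes R} {a : R} (ha : a ∉ (P : Ideal R)) :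
    a * r P + (∑ Q, r Q - r P) ∈ R⁰ := by
  refine mem_nonZeroDivisors_of_forall_notMem_minimalPrimes fun Q hQ h => ?_
  have := hQ.1.1
  by_cases hPQ : P = ⟨Q, hQ⟩
  · subst hPQ
    have h1 := (Ideal.add_mem_iff_left _ (hr.sum_sub_mem ⟨Q, hQ⟩)).1 h
    exact (this.mem_or_mem h1).elim ha fun h2 => (hr ⟨Q, hQ⟩ ⟨Q, hQ⟩).1 h2 rfl
  · have hrQ := (hr P ⟨Q, hQ⟩).2 hPQ
    have h1 := (Ideal.add_mem_iff_right _ (Ideal.mul_mem_left _ a hrQ)).1 h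
    exact notMem_of_mem_nonZeroDivisors hr.sum_mem_nonZeroDivisors hQ
      (by simpa using add_mem h1 hrQ)

end SeparatesMinimalPrimes
end MinimalPrimes

/-! ### Modules on which a multiplicative set acts bijectively -/

section ActsBijectively

/-- Every element of the submonoid `S` acts on `M` bijectively. For `S = R⁰` this says that `M` is
a module over the total ring of fractions of `R`, for `S = P.primeCompl` that it is a module over
`R_P`. -/
def ActsBijectively {R : Type u} [CommRing R] (S : Submonoid R) (M : Type v) [AddCommGroup M]
    [Module R M] : Prop :=
  ∀ s ∈ S, Function.Bijective fun x : M => s • x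

variable {R : Type u} [CommRing R] {M : Type v} [AddCommGroup M] [Module R M]

theorem ActsBijectively.isLocalizedModule_id {S : Submonoid R} (h : ActsBijectively S M) :
    IsLocalizedModule S (LinearMap.id : M →ₗ[R] M) where
  map_units s := (Module.End.isUnit_iff _).2 (h s s.2)
  surj y := ⟨⟨y, 1⟩, by simp⟩
  exists_of_eq h := ⟨1, by simpa using h⟩

/-- Injective modules are divisible: `r * a ↦ a • y` on the ideal generated by `r` extends to `R`,
and the image of `1` is then a preimage of `y`. -/
theorem Module.Injective.smul_surjective [Small.{v} R] (hM : Module.Injective R M) {r : R}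
    (hr : r ∈ R⁰) : Function.Surjective fun x : M => r • x := by
  intro y
  have hinj : Function.Injective (LinearMap.mulLeft R r) := fun a b hab =>
    mul_cancel_left_mem_nonZeroDivisors hr |>.1 hab
  let e := LinearEquiv.ofInjective (LinearMap.mulLeft R r) hinj
  obtain ⟨g, hg⟩ := Module.Baer.of_injective hM (LinearMap.range (LinearMap.mulLeft R r))
    (LinearMap.toSpanSingleton R M y ∘ₗ e.symm.toLinearMap)
  refine ⟨g 1, ?_⟩
  have he : (e 1 : R) = r := mul_one r
  have hg1 : g (e 1 : R) = (LinearMap.toSpanSingleton R M y ∘ₗ e.symm.toLinearMap) (e 1) :=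
    hg (e 1) (e 1).2
  rw [LinearMap.comp_apply, LinearEquiv.coe_coe, e.symm_apply_apply, he] at hg1
  simpa [← map_smul] using hg1

theorem IsHopfian.actsBijectively [Small.{v} R] (hM : Module.Injective R M)
    (h : IsHopfian R M) : ActsBijectively R⁰ M := fun r hr =>
  h (LinearMap.lsmul R M r) (hM.smul_surjective hr)

/-- On a module killed by the minimal prime `P`, bijectivity of the regular elements extends to all
elements outside `P`, since each of these is regular up to a factor outside `P` and a summand
in `P`. -/
theorem ActsBijectively.primeCompl [Fintype (minimalPrimes R)] [IsReduced R]
    (h : ActsBijectively R⁰ M) (P : minimalPrimes R)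
    (hP : ∀ p ∈ (P : Ideal R), ∀ x : M, p • x = 0) :
    haveI := P.2.1.1
    ActsBijectively (P : Ideal R).primeCompl M := by
  obtain ⟨r, hr⟩ := exists_separatesMinimalPrimes (R := R)
  intro a ha
  -- the regular element `t` acts on `M` as `a * r P`
  have ht := h _ (hr.mul_add_mem_nonZeroDivisors ha)
  have key : ∀ x : M, (a * r P + (∑ Q, r Q - r P)) • x = (a * r P) • x := fun x => by
    rw [add_smul, hP _ (hr.sum_sub_mem P), add_zero]
  simp only [key] at ht
  refine ⟨Function.Injective.of_comp (f := fun x : M => r P • x) ?_, fun y => ?_⟩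
  · convert ht.1 using 2 with x
    simp [smul_smul, mul_comm]
  · obtain ⟨x, hx⟩ := ht.2 y
    exact ⟨r P • x, by simpa [smul_smul] using hx⟩

theorem ActsBijectively.torsionBySet {S : Submonoid R} (h : ActsBijectively S M) (I : Set R) :
    ActsBijectively S (Submodule.torsionBySet R M I) := by
  intro s hs
  refine ⟨fun x y hxy => Subtype.ext ((h s hs).1 (congrArg Subtype.val hxy)), fun y => ?_⟩
  obtain ⟨x, hx⟩ := (h s hs).2 y
  refine ⟨⟨x, (Submodule.mem_torsionBySet_iff _ _).2 fun p => (h s hs).1 ?_⟩, Subtype.ext hx⟩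
  have hy := (Submodule.mem_torsionBySet_iff _ _).1 y.2 p
  have hx : s • x = (y : M) := hx
  simp only [smul_zero]
  rw [smul_comm, hx, hy]

/-- If the regular elements act bijectively, every `x` is `(∑ P, r P) • y` for some `y`, and
`r P • y` is the component of `x` killed by `P`. -/
theorem ActsBijectively.isInternal_torsionBySet [Fintype (minimalPrimes R)]
    [DecidableEq (minimalPrimes R)] [IsReduced R] (h : ActsBijectively R⁰ M) :
    DirectSum.IsInternal fun P : minimalPrimes R =>
      Submodule.torsionBySet R M ((P : Ideal R) : Set R) := by
  obtain ⟨r, hr⟩ := exists_separatesMinimalPrimes (R := R)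
  have hs := h _ hr.sum_mem_nonZeroDivisors
  refine DirectSum.isInternal_submodule_of_iSupIndep_of_iSup_eq_top ?_ ?_
  · intro P
    rw [disjoint_iff, Submodule.eq_bot_iff]
    rintro x ⟨hx, hx'⟩
    have hP : ∀ p ∈ (P : Ideal R), p • x = 0 := fun p hp =>
      (Submodule.mem_torsionBySet_iff _ _).1 hx ⟨p, hp⟩
    have hle : (⨆ Q, ⨆ (_ : Q ≠ P), Submodule.torsionBySet R M ((Q : Ideal R) : Set R)) ≤
        Submodule.torsionBy R M (r P) := by
      refine iSup₂_le fun Q hQ y hy => ?_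
      exact (Submodule.mem_torsionBySet_iff _ _).1 hy ⟨r P, (hr P Q).2 hQ.symm⟩
    have hrP : r P • x = 0 := hle hx'
    refine hs.1 ?_
    have := hP _ (hr.sum_sub_mem P)
    simpa [sub_smul, hrP] using this
  · refine eq_top_iff.2 fun x _ => ?_
    obtain ⟨y, rfl⟩ := hs.2 x
    simp only [Finset.sum_smul]
    refine sum_mem fun P _ => Submodule.mem_iSup_of_mem P ?_
    refine (Submodule.mem_torsionBySet_iff _ _).2 fun p => ?_
    rw [smul_smul, hr.mul_eq_zero p.2, zero_smul]

end ActsBijectively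

/-! ### Hopfian and co-Hopfian direct sums -/

section HopfianTransfer
variable {R : Type u} [Ring R] {M : Type v} [AddCommGroup M] [Module R M]
  {N : Type w} [AddCommGroup N] [Module R N]

theorem IsHopfian.of_linearEquiv (e : M ≃ₗ[R] N) (h : IsHopfian R M) : IsHopfian R N := by
  intro f hf
  have := h (e.symm.toLinearMap ∘ₗ f ∘ₗ e.toLinearMap)
    (e.symm.surjective.comp (hf.comp e.surjective))
  have h2 := e.bijective.comp (this.comp e.symm.bijective)
  convert h2 using 1
  ext x
  simp

theorem IsCoHopfian.of_linearEquiv (e : M ≃ₗ[R] N) (h : IsCoHopfian R M) : IsCoHopfian R N := by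
  intro f hf
  have := h (e.symm.toLinearMap ∘ₗ f ∘ₗ e.toLinearMap)
    (e.symm.injective.comp (hf.comp e.injective))
  have h2 := e.bijective.comp (this.comp e.symm.bijective)
  convert h2 using 1
  ext x
  simp

variable {ι : Type w} {V : ι → Type v} [∀ i, AddCommGroup (V i)]
  [∀ i, Module R (V i)]

theorem DirectSum.lmap_injective_iff (f : ∀ i, V i →ₗ[R] V i) :
    Function.Injective (DirectSum.lmap f) ↔ ∀ i, Function.Injective (f i) :=
  DFinsupp.mapRange_injective _ fun i => map_zero (f i)

theorem DirectSum.lmap_surjective_iff (f : ∀ i, V i →ₗ[R] V i) :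
    Function.Surjective (DirectSum.lmap f) ↔ ∀ i, Function.Surjective (f i) :=
  DFinsupp.mapRange_surjective _ fun i => map_zero (f i)

theorem IsCoHopfian.of_directSum [DecidableEq ι] (h : IsCoHopfian R (⨁ i, V i)) (i : ι) :
    IsCoHopfian R (V i) := by
  intro f hf
  refine ⟨hf, ?_⟩
  let F : ∀ j, V j →ₗ[R] V j := Function.update (fun _ => LinearMap.id) i f
  have hF : Function.Surjective (DirectSum.lmap F) := by
    refine (h _ ((DirectSum.lmap_injective_iff F).2 fun j => ?_)).2
    by_cases hj : j = i
    · subst hj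
      simpa [F] using hf
    · simpa [F, hj] using Function.injective_id
  simpa [F] using (DirectSum.lmap_surjective_iff F).1 hF i

/-- If there are no nonzero maps between distinct summands, then every endomorphism of the direct
sum is diagonal, so the direct sum inherits bi-Hopficity from its summands. -/
theorem IsBiHopfian.directSum [DecidableEq ι] (hV : ∀ i, IsBiHopfian R (V i))
    (h0 : ∀ i j, i ≠ j → ∀ f : V i →ₗ[R] V j, f = 0) : IsBiHopfian R (⨁ i, V i) := by
  have key : ∀ f : (⨁ i, V i) →ₗ[R] (⨁ i, V i), ∃ F : ∀ i, V i →ₗ[R] V i,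
      f = DirectSum.lmap F := by
    intro f
    refine ⟨fun i => DirectSum.component R ι V i ∘ₗ f ∘ₗ DirectSum.lof R ι V i, ?_⟩
    refine DirectSum.linearMap_ext R fun i => LinearMap.ext fun x => DFinsupp.ext fun j => ?_
    by_cases hij : i = j
    · subst hij
      simp [DirectSum.lmap_lof, DirectSum.component]
    · have := LinearMap.congr_fun
        (h0 i j hij (DirectSum.component R ι V j ∘ₗ f ∘ₗ DirectSum.lof R ι V i)) x
      have h2 : f (DirectSum.lof R ι V i x) j = 0 := this
      simp only [LinearMap.comp_apply, h2, DirectSum.lmap_lof]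
      exact (DirectSum.of_eq_of_ne i j _ (Ne.symm hij)).symm
  refine ⟨fun f hf => ?_, fun f hf => ?_⟩ <;> obtain ⟨F, rfl⟩ := key f
  · exact ⟨(DirectSum.lmap_injective_iff F).2 fun i =>
      ((hV i).1 _ ((DirectSum.lmap_surjective_iff F).1 hf i)).1, hf⟩
  · exact ⟨hf, (DirectSum.lmap_surjective_iff F).2 fun i =>
      ((hV i).2 _ ((DirectSum.lmap_injective_iff F).1 hf i)).2⟩

/-- An infinite basis has a non-surjective injective self-map, and this induces a non-surjective
injective endomorphism. -/
theorem IsCoHopfian.finite_of_finsupp [Nontrivial M] {κ : Type w} (h : IsCoHopfian R (κ →₀ M)) :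
    Finite κ := by
  by_contra hκ
  rw [not_finite_iff_infinite] at hκ
  obtain ⟨g, hg, hg'⟩ : ∃ g : κ → κ, Function.Injective g ∧ ¬ Function.Surjective g := by
    have hcard : Cardinal.mk (Option κ) = Cardinal.mk κ := by
      rw [Cardinal.mk_option, Cardinal.add_one_eq (Cardinal.aleph0_le_mk κ)]
    obtain ⟨e⟩ := Cardinal.eq.1 hcard
    refine ⟨e ∘ some, e.injective.comp (Option.some_injective κ), fun hsurj => ?_⟩
    obtain ⟨k, hk⟩ := hsurj (e none)
    exact Option.some_ne_none k (e.injective hk)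
  obtain ⟨k, hk⟩ := not_forall.1 hg'
  obtain ⟨m, hm⟩ := exists_ne (0 : M)
  obtain ⟨x, hx⟩ := (h (Finsupp.lmapDomain M R g) (Finsupp.mapDomain_injective hg)).2
    (Finsupp.single k m)
  have := congrArg (fun z => z k) hx
  have h2 : Finsupp.mapDomain g x k = m := by simpa using this
  rw [Finsupp.mapDomain_of_notMem_range _ _ (fun ⟨a, ha⟩ => hk ⟨a, ha⟩)] at h2
  exact hm h2.symm

end HopfianTransfer

/-! ### The fields `R_P` -/

section LocalizationAtMinimalPrime
variable {R : Type u} [CommRing R]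

/-- Elements of `P` vanish in `R_P`, because they are killed by `r P`, which is outside `P`. -/
theorem Localization.AtPrime.isField_of_mem_minimalPrimes [IsReduced R]
    [Fintype (minimalPrimes R)] (P : Ideal R) [P.IsPrime] (hP : P ∈ minimalPrimes R) :
    IsField (Localization.AtPrime P) := by
  obtain ⟨r, hr⟩ := exists_separatesMinimalPrimes (R := R)
  refine ⟨⟨0, 1, zero_ne_one⟩, mul_comm, fun {x} hx => ?_⟩
  obtain ⟨⟨a, s⟩, rfl⟩ := IsLocalization.mk'_surjective P.primeCompl x
  have ha : a ∈ P.primeCompl := by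
    intro ha
    refine hx ((IsLocalization.mk'_eq_zero_iff a s).2
      ⟨⟨r ⟨P, hP⟩, fun h => (hr ⟨P, hP⟩ ⟨P, hP⟩).1 h rfl⟩, ?_⟩)
    rw [mul_comm]
    exact hr.mul_eq_zero (P := ⟨P, hP⟩) ha
  exact ⟨IsLocalization.mk' _ (s : R) ⟨a, ha⟩, IsLocalization.mk'_mul_mk'_eq_one ⟨a, ha⟩ s⟩

variable {P : Ideal R} [P.IsPrime]

/-- If `R_P` is a field, modules on which `R ∖ P` acts bijectively are vector spaces over `R_P`. -/
theorem ActsBijectively.exists_linearEquiv_finsupp (hP : IsField (Localization.AtPrime P))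
    {M : Type v} [AddCommGroup M] [Module R M] (h : ActsBijectively P.primeCompl M) :
    ∃ κ : Type (max u v), Nonempty (M ≃ₗ[R] (κ →₀ Localization.AtPrime P)) := by
  have := h.isLocalizedModule_id
  let := hP.toField
  let V := LocalizedModule P.primeCompl M
  let b := Module.Free.chooseBasis (Localization.AtPrime P) V
  exact ⟨_, ⟨(IsLocalizedModule.iso P.primeCompl (LinearMap.id : M →ₗ[R] M)).symm.trans
    (b.repr.restrictScalars R)⟩⟩

/-- An `R`-linear endomorphism of a finite-dimensional `R_P`-vector space is `R_P`-linear, so it is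
injective if and only if it is surjective. -/
theorem isBiHopfian_finsupp_localization (hP : IsField (Localization.AtPrime P))
    (κ : Type w) [Finite κ] : IsBiHopfian R (κ →₀ Localization.AtPrime P) := by
  let := hP.toField
  have key : ∀ f : (κ →₀ Localization.AtPrime P) →ₗ[R] (κ →₀ Localization.AtPrime P),
      Function.Injective f ↔ Function.Surjective f := fun f =>
    LinearMap.injective_iff_surjective
      (f := f.extendScalarsOfIsLocalization P.primeCompl (Localization.AtPrime P))
  exact ⟨fun f hf => ⟨(key f).2 hf, hf⟩, fun f hf => ⟨hf, (key f).1 hf⟩⟩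

theorem Localization.AtPrime.smul_eq_zero_of_isField (hP : IsField (Localization.AtPrime P))
    {κ : Type w} {a : R} (ha : a ∈ P) (x : κ →₀ Localization.AtPrime P) : a • x = 0 := by
  have h0 : algebraMap R (Localization.AtPrime P) a = 0 := by
    by_contra h
    obtain ⟨b, hb⟩ := hP.mul_inv_cancel h
    exact (IsLocalization.AtPrime.isUnit_to_map_iff (Localization.AtPrime P) P a).1
      (IsUnit.of_mul_eq_one _ hb) ha
  ext k
  simp [Algebra.smul_def, h0]

/-- An element of `P` outside `Q` kills the source and acts injectively on the target. -/
theorem linearMap_finsupp_localization_eq_zero {Q : Ideal R} [Q.IsPrime]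
    (hP : IsField (Localization.AtPrime P)) (hPQ : ¬ P ≤ Q) {κ : Type v} {μ : Type w}
    (f : (κ →₀ Localization.AtPrime P) →ₗ[R] (μ →₀ Localization.AtPrime Q)) : f = 0 := by
  obtain ⟨a, haP, haQ⟩ := SetLike.not_le_iff_exists.1 hPQ
  ext1 k
  refine LinearMap.ext fun x => ?_
  have h1 : a • f (Finsupp.single k x) = 0 := by
    rw [← map_smul, Localization.AtPrime.smul_eq_zero_of_isField hP haP, map_zero]
  refine Finsupp.ext fun m => ?_
  have h2 := DFunLike.congr_fun h1 m
  simp only [Finsupp.smul_apply, Finsupp.zero_apply, Algebra.smul_def] at h2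
  exact ((IsLocalization.map_units (Localization.AtPrime Q)
    (⟨a, haQ⟩ : Q.primeCompl)).mul_right_eq_zero).1 h2

end LocalizationAtMinimalPrime

/-! ### Injective envelopes of `R ⧸ P` -/

section InjectiveEnvelope
variable {R : Type u} [CommRing R] {E : Type v} [AddCommGroup E] [Module R E]

theorem IsEssentialSubmodule.exists_smul_mem {N : Submodule R E} (hN : IsEssentialSubmodule N)
    {x : E} (hx : x ≠ 0) : ∃ a : R, a • x ∈ N ∧ a • x ≠ 0 := by
  by_contra! hcon
  refine hx ((Submodule.span_singleton_eq_bot (R := R)).1 (hN _ ?_))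
  refine (Submodule.eq_bot_iff _).2 fun y hy => ?_
  obtain ⟨a, rfl⟩ := Submodule.mem_span_singleton.1 hy.2
  exact hcon a hy.1

/-- Elements outside `P` are regular on `R ⧸ P`, hence on its essential extensions. -/
theorem IsInjectiveEnvelope.smul_injective {P : Ideal R} [hP : P.IsPrime] {i : R ⧸ P →ₗ[R] E}
    (hi : IsInjectiveEnvelope i) {a : R} (ha : a ∉ P) : Function.Injective fun x : E => a • x := by
  have : LinearMap.ker (LinearMap.lsmul R E a) = ⊥ := by
    refine hi.essential _ ((Submodule.eq_bot_iff _).2 ?_)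
    rintro _ ⟨⟨y, rfl⟩, hy⟩
    obtain ⟨b, rfl⟩ := Ideal.Quotient.mk_surjective y
    have hy : a • i (Ideal.Quotient.mk P b) = 0 := hy
    rw [← map_smul, ← i.map_zero] at hy
    have h1 : Ideal.Quotient.mk P (a * b) = 0 := by
      simpa [Algebra.smul_def] using hi.injective hy
    have h2 := (hP.mem_or_mem (Ideal.Quotient.eq_zero_iff_mem.1 h1)).resolve_left ha
    rw [Ideal.Quotient.eq_zero_iff_mem.2 h2, map_zero]
  exact LinearMap.ker_eq_bot.1 this

/-- A regular element of `Q` acts surjectively on the envelope of `R ⧸ Q` but kills `R ⧸ Q`. -/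
theorem IsInjectiveEnvelope.not_isHopfian [IsNoetherianRing R] [IsReduced R] [Small.{v} R]
    {Q : Ideal R} (hQ : Q.IsPrime) (hQm : Q ∉ minimalPrimes R) {i : R ⧸ Q →ₗ[R] E}
    (hi : IsInjectiveEnvelope i) : ¬ IsHopfian R E := by
  intro h
  obtain ⟨a, haQ, ha⟩ := exists_mem_nonZeroDivisors_of_notMem_minimalPrimes hQ hQm
  have h1 : a • i 1 = a • (0 : E) := by
    have : a • (1 : R ⧸ Q) = 0 := by
      rw [Algebra.smul_def, mul_one]
      exact Ideal.Quotient.eq_zero_iff_mem.2 haQ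
    rw [← map_smul, this, map_zero, smul_zero]
  have h2 := (h.actsBijectively hi.module_injective a ha).1 h1
  exact one_ne_zero (hi.injective (h2.trans i.map_zero.symm))

/-- For a minimal prime `P`, the injective envelope of `R ⧸ P` is `R_P`, because the map from `R`
to the envelope has the defining properties of the localization `R → R_P`: the envelope is killed
by `P`, elements outside `P` act bijectively on it, and essentiality provides the denominators. -/
theorem IsInjectiveEnvelope.nonempty_linearEquiv_localization [IsReduced R] [Small.{v} R]
    [Fintype (minimalPrimes R)] {P : Ideal R} [hPp : P.IsPrime] (hP : P ∈ minimalPrimes R)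
    {i : R ⧸ P →ₗ[R] E} (hi : IsInjectiveEnvelope i) :
    Nonempty (E ≃ₗ[R] Localization.AtPrime P) := by
  obtain ⟨r, hr⟩ := exists_separatesMinimalPrimes (R := R)
  have hrP : r ⟨P, hP⟩ ∉ P := fun h => (hr ⟨P, hP⟩ ⟨P, hP⟩).1 h rfl
  have hreg : ActsBijectively R⁰ E := fun a ha =>
    ⟨hi.smul_injective (notMem_of_mem_nonZeroDivisors ha hP),
      hi.module_injective.smul_surjective ha⟩
  have htor : ∀ p ∈ P, ∀ x : E, p • x = 0 := fun p hp x => by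
    refine hi.smul_injective hrP ?_
    simp only [smul_zero, smul_smul]
    rw [mul_comm, hr.mul_eq_zero (P := ⟨P, hP⟩) hp, zero_smul]
  have hbij : ActsBijectively P.primeCompl E := hreg.primeCompl ⟨P, hP⟩ htor
  let g : R →ₗ[R] E := i ∘ₗ Submodule.mkQ P
  have hloc : IsLocalizedModule P.primeCompl g :=
    { map_units := fun s => (Module.End.isUnit_iff _).2 (hbij s s.2)
      surj := fun x => by
        by_cases hx : x = 0
        · exact ⟨⟨0, 1⟩, by simp [hx]⟩
        obtain ⟨a, ⟨y, hy⟩, ha⟩ := hi.essential.exists_smul_mem hx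
        obtain ⟨b, rfl⟩ := Submodule.mkQ_surjective P y
        exact ⟨⟨b, ⟨a, fun haP => ha (htor a haP x)⟩⟩, hy.symm⟩
      exists_of_eq := fun {a b} hab => by
        have h1 := hi.injective hab
        have h2 : a - b ∈ P := (Submodule.Quotient.eq P).1 h1
        refine ⟨⟨r ⟨P, hP⟩, hrP⟩, ?_⟩
        have := hr.mul_eq_zero (P := ⟨P, hP⟩) h2
        rw [sub_mul, sub_eq_zero] at this
        simpa [Submonoid.smul_def, mul_comm] using this }
  exact ⟨IsLocalizedModule.linearEquiv P.primeCompl g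
    (Algebra.linearMap R (Localization.AtPrime P))⟩

end InjectiveEnvelope

/-! ### Bi-Hopfian injective modules -/

theorem corollary2p6 (R : Type u) [CommRing R] [IsNoetherianRing R] [IsReduced R]
    [Small.{v} R] :
    (minimalPrimes R).Finite ∧
    (∀ (E : Type v) [AddCommGroup E] [Module R E], Module.Injective R E →
      (IsBiHopfian R E ↔
        ∃ n : minimalPrimes R → ℕ, Nonempty
          (E ≃ₗ[R] (⨁ P : minimalPrimes R, ⨁ _ : Fin (n P),
            (injectiveEnvelope.{u, u} R (R ⧸ (P : Ideal R)) : Type u))))) ∧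
    (∀ Q : Ideal R, Q.IsPrime → Q ∉ minimalPrimes R →
      ¬ IsHopfian R (injectiveEnvelope.{u, u} R (R ⧸ Q))) := by
  classical
  have hfin : (minimalPrimes R).Finite := minimalPrimes.finite_of_isNoetherianRing R
  let : Fintype (minimalPrimes R) := hfin.fintype
  have hprime : ∀ P : minimalPrimes R, (P : Ideal R).IsPrime := fun P => P.2.1.1
  have hfield : ∀ P : minimalPrimes R, IsField (Localization.AtPrime (P : Ideal R)) := fun P =>
    Localization.AtPrime.isField_of_mem_minimalPrimes _ P.2
  have henv : ∀ P : minimalPrimes R, Nonempty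
      ((injectiveEnvelope.{u, u} R (R ⧸ (P : Ideal R)) : Type u) ≃ₗ[R]
        Localization.AtPrime (P : Ideal R)) := fun P =>
    (isInjectiveEnvelope_injectiveEnvelopeEmbedding R
      (R ⧸ (P : Ideal R))).nonempty_linearEquiv_localization P.2
  -- Replace every envelope by the corresponding localization.
  have hsum : ∀ n : minimalPrimes R → ℕ, Nonempty
      ((⨁ P : minimalPrimes R, ⨁ _ : Fin (n P),
        (injectiveEnvelope.{u, u} R (R ⧸ (P : Ideal R)) : Type u)) ≃ₗ[R]
      (⨁ P : minimalPrimes R, (Fin (n P) →₀ Localization.AtPrime (P : Ideal R)))) := fun n =>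
    ⟨DFinsupp.mapRange.linearEquiv fun P =>
      (DFinsupp.mapRange.linearEquiv fun _ => (henv P).some).trans
        (finsuppLEquivDirectSum R _ _).symm⟩
  refine ⟨hfin, fun E _ _ hE => ⟨fun hbi => ?_, ?_⟩, fun Q hQ hQm =>
    (isInjectiveEnvelope_injectiveEnvelopeEmbedding R (R ⧸ Q)).not_isHopfian hQ hQm⟩
  · have hreg := hbi.1.actsBijectively hE
    -- The `P`-torsion parts decompose `E`, and each is a vector space over `R_P` on a basis `κ P`.
    let T : minimalPrimes R → Submodule R E := fun P =>
      Submodule.torsionBySet R E ((P : Ideal R) : Set R)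
    have e : (⨁ P, T P) ≃ₗ[R] E :=
      LinearEquiv.ofBijective (DirectSum.coeLinearMap T) hreg.isInternal_torsionBySet
    have hT : ∀ P : minimalPrimes R, ActsBijectively (P : Ideal R).primeCompl (T P) := fun P =>
      (hreg.torsionBySet _).primeCompl P fun p hp x =>
        Subtype.ext ((Submodule.mem_torsionBySet_iff _ _).1 x.2 ⟨p, hp⟩)
    choose κ hκ using fun P : minimalPrimes R => (hT P).exists_linearEquiv_finsupp (hfield P)
    have hcoh : IsCoHopfian R (⨁ P, T P) := hbi.2.of_linearEquiv e.symm
    have hκfin : ∀ P : minimalPrimes R, Finite (κ P) := fun P =>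
      ((hcoh.of_directSum P).of_linearEquiv (hκ P).some).finite_of_finsupp
    let e' : (⨁ P, T P) ≃ₗ[R] (⨁ P : minimalPrimes R,
        (Fin (Nat.card (κ P)) →₀ Localization.AtPrime (P : Ideal R))) :=
      DFinsupp.mapRange.linearEquiv fun P =>
        (hκ P).some.trans (Finsupp.domLCongr (Finite.equivFin (κ P)))
    exact ⟨fun P => Nat.card (κ P), ⟨(e.symm.trans e').trans (hsum _).some.symm⟩⟩
  · rintro ⟨n, ⟨e⟩⟩
    have h : IsBiHopfian R
        (⨁ P : minimalPrimes R, (Fin (n P) →₀ Localization.AtPrime (P : Ideal R))) :=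
      IsBiHopfian.directSum (fun P => isBiHopfian_finsupp_localization (hfield P) _)
        fun P Q hPQ f => linearMap_finsupp_localization_eq_zero (hfield P)
          (fun hle => hPQ (Subtype.ext (minimalPrimes_eq_of_le (hprime P) Q.2 hle))) f
    have e' := (e.trans (hsum n).some).symm
    exact ⟨h.1.of_linearEquiv e', h.2.of_linearEquiv e'⟩
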